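/- For $t>0$, let $p_t(x,y)=t^{-n/2}\exp(-\pi|x-y|^2/t)$ $(x,y\in\mathbb R^n)$ be the heat kernel, and let $P_t$ be the heat operator on $L^2(\mathbb R^n)$, $P_tf(x)=\int_{\mathbb R^n}p_t(x,y)f(y)\,dy$. Let $t>0$, let $k:\mathbb R^n\times\mathbb R^n\to\mathbb C$ be locally integrable, and let $K$ be the operator on $L^2(\mathbb R^n)$ with kernel $k$: for every $f\in L^2(\mathbb R^n)$, $Kf(x)=\int_{\mathbb R^n}k(x,y)f(y)\,dy$ for almost every $x$, the integral being absolutely convergent. Suppose that $$|k(x,y)|\le p_t(x,y)\ \text{ for almost all }(x,y)\in\mathbb R^n\times\mathbb R^n,\qquad \|Kf\|_2\le\|P_tf\|_2\ \text{ for all } f\in L^2(\mathbb R^n).$$ Then there is a bounded measurable function $m:\mathbb R^n\to\mathbb C$ such that $$k(x,y)=m(x)\,p_t(x,y)\ \text{ for almost all }(x,y)\in\mathbb R^n\times\mathbb R^n,$$ and $K$ is the heat operator $P_t$ followed by multiplication by $m$; that is, $Kf=m\cdot P_tf$ in $L^2(\mathbb R^n)$ for all $f\in L^2(\mathbb R^n)$.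 -/

import Mathlib

open MeasureTheory
open scoped ENNReal

/-- Euclidean space `ℝⁿ`, with its Euclidean norm and Lebesgue measure. -/
abbrev Eucl (n : ℕ) : Type := EuclideanSpace ℝ (Fin n)

/-- The complex Hilbert space `L²(ℝⁿ)`. -/
abbrev LTwo (n : ℕ) : Type := Lp ℂ 2 (volume : Measure (Eucl n))

/-- `K` is the operator on `L²(ℝⁿ)` given by the kernel `k`: for every `f` in `L²(ℝⁿ)` and almost
every `x`, the integral `∫ k(x,y) f(y) dy` converges absolutely and is equal to `K f (x)`. -/
def HasKernel {n : ℕ} (K : LTwo n →ₗ[ℂ] LTwo n) (k : Eucl n → Eucl n → ℂ) : Prop :=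
  ∀ f : LTwo n, ∀ᵐ x : Eucl n,
    Integrable (fun y => k x y * f y) ∧ K f x = ∫ y, k x y * f y

/-- The heat kernel `p_t(x,y) = t^(-n/2) exp(-π |x-y|² / t)`. -/
noncomputable def heatKernel {n : ℕ} (t : ℝ) (x y : Eucl n) : ℝ :=
  1 / t ^ ((n : ℝ) / 2) * Real.exp (-(Real.pi * ‖x - y‖ ^ 2 / t))

section heat

theorem heatKernel_nonneg {n : ℕ} {t : ℝ} (ht : 0 < t) (x y : Eucl n) :
    0 ≤ heatKernel t x y := by
  unfold heatKernel; positivity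

theorem heatKernel_comm {n : ℕ} (t : ℝ) (x y : Eucl n) :
    heatKernel t x y = heatKernel t y x := by
  unfold heatKernel; rw [norm_sub_rev]

theorem continuous_heatKernel {n : ℕ} (t : ℝ) :
    Continuous fun z : Eucl n × Eucl n => heatKernel t z.1 z.2 := by
  unfold heatKernel; fun_prop

theorem continuous_heatKernel_right {n : ℕ} (t : ℝ) (x : Eucl n) :
    Continuous fun y : Eucl n => heatKernel t x y := by
  unfold heatKernel; fun_prop

theorem integral_heatKernel {n : ℕ} {t : ℝ} (ht : 0 < t) (x : Eucl n) :
    ∫ y, heatKernel t x y = 1 := by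
  have hb : 0 < Real.pi / t := by positivity
  have h := GaussianFourier.integral_rexp_neg_mul_sq_norm (V := Eucl n) hb
  have h2 := integral_sub_left_eq_self
    (fun v : Eucl n => Real.exp (-(Real.pi / t) * ‖v‖ ^ 2)) volume x
  have e : Real.pi / (Real.pi / t) = t := by field_simp
  rw [e, finrank_euclideanSpace_fin] at h
  have e2 : ∀ y : Eucl n, heatKernel t x y
      = 1 / t ^ ((n : ℝ) / 2) * Real.exp (-(Real.pi / t) * ‖x - y‖ ^ 2) := by
    intro y; unfold heatKernel; congr 2; ring
  simp_rw [e2]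
  rw [integral_const_mul, h2, h]
  have : 0 < t ^ ((n : ℝ) / 2) := by positivity
  field_simp

theorem integrable_heatKernel {n : ℕ} {t : ℝ} (ht : 0 < t) (x : Eucl n) :
    Integrable fun y => heatKernel t x y := by
  by_contra h
  have := integral_heatKernel ht x
  rw [integral_undef h] at this
  exact zero_ne_one this

theorem lintegral_heatKernel {n : ℕ} {t : ℝ} (ht : 0 < t) (x : Eucl n) :
    ∫⁻ y, ENNReal.ofReal (heatKernel t x y) = 1 := by
  rw [← ofReal_integral_eq_lintegral_ofReal (integrable_heatKernel ht x)
    (ae_of_all _ fun y => heatKernel_nonneg ht x y), integral_heatKernel ht x, ENNReal.ofReal_one]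

theorem memLp_heatKernel {n : ℕ} {t : ℝ} (ht : 0 < t) (x : Eucl n) :
    MemLp (fun y => (heatKernel t x y : ℂ)) 2 := by
  have hc : Continuous fun y => heatKernel t x y := continuous_heatKernel_right t x
  have hr : MemLp (fun y => heatKernel t x y) 2 := by
    rw [memLp_two_iff_integrable_sq hc.aestronglyMeasurable]
    have hle : ∀ y, heatKernel t x y ≤ 1 / t ^ ((n : ℝ) / 2) := fun y => by
      unfold heatKernel
      have : 0 ≤ Real.pi * ‖x - y‖ ^ 2 / t := by positivity
      exact mul_le_of_le_one_right (by positivity) (Real.exp_le_one_iff.2 (by linarith))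
    have hg := (integrable_heatKernel ht x).const_mul (1 / t ^ ((n : ℝ) / 2))
    refine hg.mono' (hc.pow 2).aestronglyMeasurable (ae_of_all _ fun y => ?_)
    rw [Real.norm_of_nonneg (sq_nonneg _), sq]
    exact mul_le_mul_of_nonneg_right (hle y) (heatKernel_nonneg ht x y)
  exact hr.ofReal

theorem integrable_heatKernel_mul {n : ℕ} {t : ℝ} (ht : 0 < t) (x : Eucl n) {f : Eucl n → ℂ}
    (hf : MemLp f 2) : Integrable fun y => (heatKernel t x y : ℂ) * f y :=
  (memLp_heatKernel ht x).integrable_mul hf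

/-- The function `x ↦ ∫ p_t(x,y) f(y) dy`. -/
noncomputable def heatFun {n : ℕ} (t : ℝ) (f : Eucl n → ℂ) (x : Eucl n) : ℂ :=
  ∫ y, (heatKernel t x y : ℂ) * f y

theorem enorm_heatFun_sq_le {n : ℕ} {t : ℝ} (ht : 0 < t) {f : Eucl n → ℂ} (hf : MemLp f 2)
    (x : Eucl n) :
    ‖heatFun t f x‖ₑ ^ (2 : ℝ)
      ≤ ∫⁻ y, ENNReal.ofReal (heatKernel t x y) * ‖f y‖ₑ ^ (2 : ℝ) := by
  have hc : Measurable fun y => ENNReal.ofReal (heatKernel t x y) :=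
    (continuous_heatKernel_right t x).measurable.ennreal_ofReal
  have hm := hf.aestronglyMeasurable.enorm
  have h1 : ‖heatFun t f x‖ₑ ≤ ∫⁻ y, ENNReal.ofReal (heatKernel t x y) ^ (1 / 2 : ℝ) *
      (ENNReal.ofReal (heatKernel t x y) * ‖f y‖ₑ ^ (2 : ℝ)) ^ (1 / 2 : ℝ) := by
    refine (enorm_integral_le_lintegral_enorm _).trans (lintegral_mono fun y => le_of_eq ?_)
    rw [ENNReal.mul_rpow_of_nonneg _ _ (by norm_num), ← mul_assoc,
      ← ENNReal.rpow_add_of_nonneg _ _ (by norm_num) (by norm_num), ← ENNReal.rpow_mul, enorm_mul]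
    norm_num
    congr 1
    rw [← ofReal_norm, Complex.norm_real,
      Real.norm_of_nonneg (heatKernel_nonneg ht x y)]
  have h2 := ENNReal.lintegral_mul_norm_pow_le (μ := volume) (p := 1 / 2) (q := 1 / 2)
    hc.aemeasurable (hc.aemeasurable.mul (hm.pow_const (2 : ℝ)))
    (by norm_num) (by norm_num) (by norm_num)
  have h3 := h1.trans h2
  rw [lintegral_heatKernel ht x, ENNReal.one_rpow, one_mul] at h3
  refine (ENNReal.rpow_le_rpow h3 (by norm_num : (0 : ℝ) ≤ 2)).trans (le_of_eq ?_)
  rw [← ENNReal.rpow_mul]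
  norm_num

theorem aestronglyMeasurable_heatFun {n : ℕ} (t : ℝ) {f : Eucl n → ℂ}
    (hf : AEStronglyMeasurable f) : AEStronglyMeasurable (heatFun t f) := by
  have h : AEStronglyMeasurable (fun z : Eucl n × Eucl n => (heatKernel t z.1 z.2 : ℂ) * f z.2)
      (volume.prod volume) :=
    (Complex.continuous_ofReal.comp (continuous_heatKernel t)).aestronglyMeasurable.mul
      hf.comp_snd
  exact h.integral_prod_right'

theorem eLpNorm_heatFun_le {n : ℕ} {t : ℝ} (ht : 0 < t) {f : Eucl n → ℂ} (hf : MemLp f 2) :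
    eLpNorm (heatFun t f) 2 ≤ eLpNorm f 2 := by
  rw [eLpNorm_eq_lintegral_rpow_enorm_toReal two_ne_zero ENNReal.ofNat_ne_top,
    eLpNorm_eq_lintegral_rpow_enorm_toReal two_ne_zero ENNReal.ofNat_ne_top]
  simp only [ENNReal.toReal_ofNat]
  refine ENNReal.rpow_le_rpow ?_ (by norm_num)
  have hK : Measurable fun z : Eucl n × Eucl n => ENNReal.ofReal (heatKernel t z.1 z.2) :=
    (continuous_heatKernel t).measurable.ennreal_ofReal
  have hm : AEMeasurable (fun y => ‖f y‖ₑ ^ (2 : ℝ)) :=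
    hf.aestronglyMeasurable.enorm.pow_const _
  calc ∫⁻ x, ‖heatFun t f x‖ₑ ^ (2 : ℝ)
      ≤ ∫⁻ x, ∫⁻ y, ENNReal.ofReal (heatKernel t x y) * ‖f y‖ₑ ^ (2 : ℝ) :=
        lintegral_mono fun x => enorm_heatFun_sq_le ht hf x
    _ = ∫⁻ y, ∫⁻ x, ENNReal.ofReal (heatKernel t x y) * ‖f y‖ₑ ^ (2 : ℝ) :=
        lintegral_lintegral_swap (hK.aemeasurable.mul hm.comp_snd)
    _ = ∫⁻ y, ‖f y‖ₑ ^ (2 : ℝ) := by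
        refine lintegral_congr fun y => ?_
        have hy : Measurable fun x => ENNReal.ofReal (heatKernel t y x) :=
          (continuous_heatKernel_right t y).measurable.ennreal_ofReal
        simp_rw [fun x => heatKernel_comm t x y]
        rw [lintegral_mul_const _ hy]
        rw [lintegral_heatKernel ht y, one_mul]

theorem memLp_heatFun {n : ℕ} {t : ℝ} (ht : 0 < t) {f : Eucl n → ℂ} (hf : MemLp f 2) :
    MemLp (heatFun t f) 2 :=
  ⟨aestronglyMeasurable_heatFun t hf.aestronglyMeasurable,
    (eLpNorm_heatFun_le ht hf).trans_lt hf.eLpNorm_lt_top⟩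

end heat

/-- The heat operator `P_t` on `L²(ℝⁿ)`: `P_t f (x) = ∫ p_t(x,y) f(y) dy`. -/
noncomputable def heatOp (n : ℕ) {t : ℝ} (ht : 0 < t) : LTwo n →ₗ[ℂ] LTwo n where
  toFun f := (memLp_heatFun ht (Lp.memLp f)).toLp
  map_add' f g := by
    rw [← MemLp.toLp_add]
    refine MemLp.toLp_congr _ _ (ae_of_all _ fun x => ?_)
    rw [Pi.add_apply]
    unfold heatFun
    rw [← integral_add (integrable_heatKernel_mul ht x (Lp.memLp f))
      (integrable_heatKernel_mul ht x (Lp.memLp g))]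
    refine integral_congr_ae ?_
    filter_upwards [Lp.coeFn_add f g] with y hy
    rw [hy, Pi.add_apply, mul_add]
  map_smul' c f := by
    rw [RingHom.id_apply, ← MemLp.toLp_const_smul]
    refine MemLp.toLp_congr _ _ (ae_of_all _ fun x => ?_)
    rw [Pi.smul_apply]
    unfold heatFun
    rw [← integral_smul]
    refine integral_congr_ae ?_
    filter_upwards [Lp.coeFn_smul c f] with y hy
    rw [hy, Pi.smul_apply, smul_eq_mul, smul_eq_mul]
    ring

/-- `P_t` is the operator given by the heat kernel. -/
theorem heatOp_hasKernel (n : ℕ) {t : ℝ} (ht : 0 < t) :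
    HasKernel (heatOp n ht) (fun x y => (heatKernel t x y : ℂ)) := by
  intro f
  filter_upwards [(memLp_heatFun ht (Lp.memLp f)).coeFn_toLp] with x hx
  exact ⟨integrable_heatKernel_mul ht x (Lp.memLp f), hx⟩

/-! Put `a = π/t` and test `K` on the Gaussians `g_z(u) = exp(-a|u|² + z⟨v,u⟩)`, `z` complex. The
heat operator sends `g_z` to `D exp(z²|v|²/(8a)) exp(-a|x|²/2 + (z/2)⟨v,x⟩)`, so `g_{-z/2} · P_t
g_z`, divided by `exp(z²|v|²/(8a))`, does not depend on `z`. For a set `A` consider the entire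
function `G_A(z) = exp(-z²|v|²/(8a)) ∫_A g_{-z/2} · K g_z`.

The two hypotheses control `G_A` differently. Cauchy–Schwarz and `‖Kf‖ ≤ ‖P_t f‖` give `|G_A(z)| ≤ C
exp(β (Re z)²)`, in particular boundedness on the imaginary axis. For real `z` the Gaussian is
positive, so `|k| ≤ p_t` gives `|K g_z| ≤ P_t g_z` pointwise, and `G_A` is bounded on the real axis.
Order two is critical for a quadrant, but since the growth involves only `Re z`, Phragmén–Lindelöf
still applies (`norm_le_of_quadrant_of_re_sq_growth`); by Liouville `G_A` is constant.

As `A` is arbitrary, `K g_z / P_t g_z` is a.e. independent of `z` (`ae_apply_gaussLp_eq`), hence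
equal to its value `m` at `z = 0`, which does not involve `v`. At `z = i` this says that `(k(x,·) -
m(x) p_t(x,·)) exp(-a|·|²)` has zero Fourier transform, so it vanishes. -/

/-! ### Phragmén–Lindelöf and Liouville at the critical order -/

/-- A Phragmén–Lindelöf principle in the first quadrant at the critical order two: the growth bound
only sees the real part. -/
theorem norm_le_of_quadrant_of_re_sq_growth {G : ℂ → ℂ} (hG : Differentiable ℂ G) {C β : ℝ}
    (hβ : 0 < β) (hgrow : ∀ z, ‖G z‖ ≤ C * Real.exp (β * z.re ^ 2))
    (hreal : ∀ x : ℝ, ‖G x‖ ≤ C) {z : ℂ} (hre : 0 ≤ z.re) (him : 0 ≤ z.im) : ‖G z‖ ≤ C := by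
  have hC : 0 ≤ C := (norm_nonneg _).trans (hreal 0)
  rcases hre.eq_or_lt with hre | hre
  · simpa [← hre] using hgrow z
  -- The factor `exp(iγz²)` has modulus `exp(-2γ Re z Im z)`: it is 1 on the real axis and exactly
  -- offsets `exp(β (Re z)²)` on the ray of slope `β/(2γ)`. The sector below that ray has opening `θ
  -- < π/2`, where order two is subcritical; as `γ → 0` these sectors exhaust the open quadrant and
  -- the factor disappears.
  have key : ∀ γ : ℝ, 0 < γ → z.im * (2 * γ) ≤ β * z.re →
      ‖G z‖ ≤ C * Real.exp (2 * γ * z.re * z.im) := by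
    intro γ hγ hz
    set θ := Real.arctan (β / (2 * γ)) with hθ
    have hθ0 : 0 < θ := Real.arctan_pos.2 (by positivity)
    have hθ1 : θ < Real.pi / 2 := Real.arctan_lt_pi_div_two _
    have nf : ∀ w : ℂ, ‖G (Complex.exp w) *
        Complex.exp (Complex.I * γ * (Complex.exp w) ^ 2)‖
        = ‖G (Complex.exp w)‖ *
          Real.exp (-(2 * γ * (Complex.exp w).re * (Complex.exp w).im)) := by
      intro w
      rw [norm_mul, Complex.norm_exp]
      congr 2
      simp [sq]
      ring
    have hstrip := PhragmenLindelof.horizontal_strip (a := 0) (b := θ) (C := C)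
      (f := fun w => G (Complex.exp w) * Complex.exp (Complex.I * γ * (Complex.exp w) ^ 2))
      (z := Complex.log z)
      (Differentiable.diffContOnCl (by fun_prop)) ?_ ?_ ?_ ?_ ?_
    · have hz0 : z ≠ 0 := fun h => by simp [h] at hre
      rw [nf, Complex.exp_log hz0, Real.exp_neg, ← div_eq_mul_inv,
        div_le_iff₀ (Real.exp_pos _)] at hstrip
      exact hstrip
    -- In the coordinate `w = log z` the sector is a strip of width `θ`, and order two becomes
    -- growth `exp(β exp(2|Re w|))`, admissible since `2 < π/θ`.
    · refine ⟨2, ?_, β, ?_⟩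
      · rw [sub_zero, lt_div_iff₀ hθ0]; linarith
      · refine Asymptotics.IsBigO.of_bound C ?_
        refine Filter.Eventually.filter_mono inf_le_right ?_
        rw [Filter.eventually_principal]
        rintro w ⟨hw0, hw1⟩
        rw [nf, Real.norm_of_nonneg (Real.exp_pos _).le]
        have hsin : 0 ≤ Real.sin w.im := Real.sin_nonneg_of_nonneg_of_le_pi hw0.le (by linarith)
        have hcos : 0 ≤ Real.cos w.im :=
          Real.cos_nonneg_of_mem_Icc ⟨by linarith, by linarith⟩
        have h1 : Real.exp (-(2 * γ * (Complex.exp w).re * (Complex.exp w).im)) ≤ 1 := by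
          rw [Real.exp_le_one_iff, Complex.exp_re, Complex.exp_im]
          have : 0 ≤ 2 * γ * (Real.exp w.re * Real.cos w.im) * (Real.exp w.re * Real.sin w.im) := by
            positivity
          linarith
        refine (mul_le_of_le_one_right (norm_nonneg _) h1).trans ((hgrow _).trans ?_)
        gcongr
        rw [Complex.exp_re, mul_pow, ← Real.exp_nat_mul]
        have h2 : Real.exp (((2 : ℕ) : ℝ) * w.re) ≤ Real.exp (2 * |w.re|) := by
          push_cast
          gcongr
          exact le_abs_self _
        have h3 : Real.cos w.im ^ 2 ≤ 1 := Real.cos_sq_le_one _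
        calc _ ≤ Real.exp (((2 : ℕ) : ℝ) * w.re) * 1 := by gcongr
          _ ≤ _ := by rw [mul_one]; exact h2
    · intro w hw
      rw [nf]
      have h0 : (Complex.exp w).im = 0 := by rw [Complex.exp_im, hw]; simp
      have h1 : Complex.exp w = ((Complex.exp w).re : ℂ) := Complex.ext rfl (by simp [h0])
      rw [h0, mul_zero, neg_zero, Real.exp_zero, mul_one, h1]
      exact hreal _
    · intro w hw
      rw [nf]
      have ht : Real.sin θ * (2 * γ) = β * Real.cos θ := by
        have := Real.tan_mul_cos (Real.cos_arctan_pos (β / (2 * γ))).ne'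
        rw [Real.tan_arctan, ← hθ] at this
        rw [← this]
        field_simp
      have he : β * (Complex.exp w).re ^ 2
          = 2 * γ * (Complex.exp w).re * (Complex.exp w).im := by
        rw [Complex.exp_re, Complex.exp_im, hw]
        linear_combination (-(Real.exp w.re ^ 2 * Real.cos θ)) * ht
      have h1 := hgrow (Complex.exp w)
      rw [he] at h1
      rw [Real.exp_neg, ← div_eq_mul_inv, div_le_iff₀ (Real.exp_pos _)]
      exact h1
    · rw [Complex.log_im]
      exact Complex.arg_nonneg_iff.2 him
    · have harg := abs_lt.1 (Complex.abs_arg_lt_pi_div_two_iff.2 (Or.inl hre))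
      rw [Complex.log_im, hθ, ← Real.arctan_tan harg.1 harg.2, Complex.tan_arg]
      refine Real.arctan_strictMono.monotone ?_
      rw [div_le_div_iff₀ hre (by positivity)]
      exact hz
  have hlim : Filter.Tendsto (fun γ : ℝ => C * Real.exp (2 * γ * z.re * z.im))
      (nhdsWithin 0 (Set.Ioi 0)) (nhds C) := by
    have : Continuous fun γ : ℝ => C * Real.exp (2 * γ * z.re * z.im) := by fun_prop
    have h := (this.tendsto 0).mono_left (nhdsWithin_le_nhds (s := Set.Ioi 0))
    simpa using h
  refine ge_of_tendsto hlim ?_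
  have hev : ∀ᶠ γ : ℝ in nhds 0, z.im * (2 * γ) < β * z.re := by
    have : Continuous fun γ : ℝ => z.im * (2 * γ) := by fun_prop
    refine this.tendsto 0 |>.eventually (gt_mem_nhds ?_)
    simpa using mul_pos hβ hre
  filter_upwards [self_mem_nhdsWithin, nhdsWithin_le_nhds hev] with γ h0 h1
  exact key γ h0 h1.le

/-- An entire function bounded on the real axis, of order-two growth in the real part only, is
constant. -/
theorem apply_eq_apply_of_re_sq_growth {G : ℂ → ℂ} (hG : Differentiable ℂ G) {C β : ℝ}
    (hβ : 0 < β) (hgrow : ∀ z, ‖G z‖ ≤ C * Real.exp (β * z.re ^ 2))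
    (hreal : ∀ x : ℝ, ‖G x‖ ≤ C) (z w : ℂ) : G z = G w := by
  have hup : ∀ H : ℂ → ℂ, Differentiable ℂ H → (∀ z, ‖H z‖ ≤ C * Real.exp (β * z.re ^ 2)) →
      (∀ x : ℝ, ‖H x‖ ≤ C) → ∀ z : ℂ, 0 ≤ z.re → ‖H z‖ ≤ C := by
    intro H hH hg hr z hz
    rcases le_total 0 z.im with h | h
    · exact norm_le_of_quadrant_of_re_sq_growth hH hβ hg hr hz h
    -- Conjugation carries the fourth quadrant to the first.
    · have hd : Differentiable ℂ (starRingEnd ℂ ∘ H ∘ starRingEnd ℂ) := fun u => by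
        rw [differentiableAt_conj_conj_iff]; exact hH _
      have := norm_le_of_quadrant_of_re_sq_growth hd (C := C) hβ
        (fun u => by simpa using hg (starRingEnd ℂ u)) (fun x => by simpa using hr x) (z := starRingEnd ℂ z) (by simpa using hz) (by simpa using h)
      simpa using this
  refine hG.apply_eq_apply_of_bounded ?_ z w
  rw [isBounded_iff_forall_norm_le]
  refine ⟨C, ?_⟩
  rintro _ ⟨u, rfl⟩
  rcases le_total 0 u.re with h | h
  · exact hup G hG hgrow hreal u h
  · have := hup (fun u => G (-u)) (hG.comp differentiable_neg)
      (fun u => by simpa using hgrow (-u)) (fun x => by simpa using hreal (-x)) (-u)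
      (by simpa using h)
    simpa using this

/-! ### Holomorphic parameter integrals and Fourier uniqueness -/

theorem differentiable_integral_mul_cexp {α : Type*} [MeasurableSpace α] {μ : Measure α}
    {g : α → ℂ} {L : α → ℝ} (hg : AEStronglyMeasurable g μ) (hL : AEMeasurable L μ)
    (hint : ∀ R : ℝ, Integrable (fun a => ‖g a‖ * Real.exp (R * |L a|)) μ) :
    Differentiable ℂ fun z : ℂ => ∫ a, g a * Complex.exp (z * L a) ∂μ := by
  have hLc : AEMeasurable (fun a => (L a : ℂ)) μ := Complex.measurable_ofReal.comp_aemeasurable hL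
  have hm : ∀ z : ℂ, AEStronglyMeasurable (fun a => g a * Complex.exp (z * L a)) μ := fun z =>
    hg.mul (Complex.measurable_exp.comp_aemeasurable (hLc.const_mul z)).aestronglyMeasurable
  have hb : ∀ (z : ℂ) (R : ℝ), ‖z‖ ≤ R → ∀ a, ‖Complex.exp (z * L a)‖ ≤ Real.exp (R * |L a|) := by
    intro z R hz a
    refine (Complex.norm_exp_le_exp_norm _).trans ?_
    rw [norm_mul, Complex.norm_real, Real.norm_eq_abs]
    gcongr
  intro z₀
  refine (hasDerivAt_integral_of_dominated_loc_of_deriv_le (μ := μ)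
    (F := fun z a => g a * Complex.exp (z * L a))
    (F' := fun z a => g a * Complex.exp (z * L a) * L a)
    -- One unit of the 2 covers the ball of radius one around `z₀`; the other absorbs the factor `|L
    -- a| ≤ exp |L a|` of the derivative.
    (bound := fun a => ‖g a‖ * Real.exp ((‖z₀‖ + 2) * |L a|))
    (Metric.ball_mem_nhds z₀ one_pos) (.of_forall hm) ?_
    ((hm z₀).mul hLc.aestronglyMeasurable) ?_ (hint _) ?_).2.differentiableAt
  · refine (hint ‖z₀‖).mono' (hm z₀) (.of_forall fun a => ?_)
    rw [norm_mul]
    gcongr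
    exact hb _ _ le_rfl a
  · refine .of_forall fun a z hz => ?_
    rw [norm_mul, norm_mul, mul_assoc, Complex.norm_real, Real.norm_eq_abs]
    have hz' : ‖z‖ ≤ ‖z₀‖ + 1 := by
      have := norm_le_norm_add_norm_sub' z z₀
      rw [Metric.mem_ball, dist_eq_norm] at hz
      linarith
    have h1 := hb z _ hz' a
    have h2 : |L a| ≤ Real.exp |L a| := by linarith [Real.add_one_le_exp |L a|]
    gcongr
    calc _ ≤ Real.exp ((‖z₀‖ + 1) * |L a|) * Real.exp |L a| := by gcongr
      _ = _ := by rw [← Real.exp_add]; ring_nf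
  · refine .of_forall fun a z _ => ?_
    have h : HasDerivAt (fun z : ℂ => z * (L a : ℂ)) (L a : ℂ) z := by
      simpa using (hasDerivAt_id z).mul_const (L a : ℂ)
    have := (h.cexp).const_mul (g a)
    rwa [← mul_assoc] at this

open scoped FourierTransform in
-- Each test function is the Fourier transform of a Schwartz function `Ψ`, and `∫ 𝓕g · Ψ = ∫ g · 𝓕Ψ`
-- moves the transform off `g`.
theorem ae_eq_zero_of_fourier_eq_zero {V : Type*} [NormedAddCommGroup V] [InnerProductSpace ℝ V]
    [MeasurableSpace V] [BorelSpace V] [FiniteDimensional ℝ V] {g : V → ℂ} (hg : Integrable g)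
    (h : ∀ ξ, 𝓕 g ξ = 0) : ∀ᵐ x, g x = 0 := by
  refine ae_eq_zero_of_integral_contDiff_smul_eq_zero hg.locallyIntegrable fun φ hφ hc => ?_
  have hφ' : ContDiff ℝ (⊤ : ℕ∞) (fun x => (φ x : ℂ)) := Complex.ofRealCLM.contDiff.comp hφ
  have hc' : HasCompactSupport (fun x => (φ x : ℂ)) := hc.comp_left Complex.ofReal_zero
  let Φ : SchwartzMap V ℂ := hc'.toSchwartzMap hφ'
  let Ψ : SchwartzMap V ℂ := 𝓕⁻ Φ
  have hΨ : 𝓕 Ψ = Φ := FourierTransform.fourier_fourierInv_eq Φ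
  have key := VectorFourier.integral_fourierIntegral_smul_eq_flip (μ := (volume : Measure V))
    (ν := (volume : Measure V)) (e := Real.fourierChar) (L := innerₗ V) (f := g) (g := fun x => Ψ x)
    Real.continuous_fourierChar continuous_inner hg Ψ.integrable
  have h0 : ∀ ξ, VectorFourier.fourierIntegral Real.fourierChar volume (innerₗ V) g ξ = 0 := h
  have h1 : ∀ ξ, VectorFourier.fourierIntegral Real.fourierChar volume (innerₗ V).flip
      (fun x => Ψ x) ξ = (φ ξ : ℂ) := by
    intro ξ
    rw [flip_innerₗ]
    have : (𝓕 Ψ : SchwartzMap V ℂ) ξ = (φ ξ : ℂ) := by rw [hΨ]; rfl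
    rw [← this, SchwartzMap.fourier_coe]
    rfl
  simp only [h0, h1, zero_smul, integral_zero] at key
  rw [key]
  refine integral_congr_ae (.of_forall fun x => ?_)
  simp [mul_comm]

/-! ### Complex Gaussians and their images under the heat operator -/

/-- The Gaussian `u ↦ exp (-b |u|² + z ⟨v, u⟩)` with a complex parameter `z`. -/
noncomputable def gaussExp {n : ℕ} (b : ℝ) (v : Eucl n) (z : ℂ) (u : Eucl n) : ℂ :=
  Complex.exp (-(b : ℂ) * (‖u‖ : ℂ) ^ 2 + z * (inner ℝ v u : ℝ))

theorem continuous_gaussExp {n : ℕ} (b : ℝ) (v : Eucl n) (z : ℂ) :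
    Continuous (gaussExp b v z) := by
  unfold gaussExp; fun_prop

theorem norm_gaussExp {n : ℕ} (b : ℝ) (v : Eucl n) (z : ℂ) (u : Eucl n) :
    ‖gaussExp b v z u‖ = Real.exp (-b * ‖u‖ ^ 2 + z.re * inner ℝ v u) := by
  rw [gaussExp, Complex.norm_exp]
  congr 1
  rw [← Complex.ofReal_pow, ← Complex.ofReal_neg, ← Complex.ofReal_mul, Complex.add_re,
    Complex.ofReal_re, Complex.re_mul_ofReal]

theorem integrable_gaussExp {n : ℕ} {b : ℝ} (hb : 0 < b) (v : Eucl n) (z : ℂ) :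
    Integrable (gaussExp b v z) :=
  GaussianFourier.integrable_cexp_neg_mul_sq_norm_add (b := (b : ℂ)) (by simpa using hb) z v

theorem memLp_gaussExp {n : ℕ} {b : ℝ} (hb : 0 < b) (v : Eucl n) (z : ℂ) :
    MemLp (gaussExp b v z) 2 := by
  rw [memLp_two_iff_integrable_sq_norm (continuous_gaussExp b v z).aestronglyMeasurable]
  refine (integrable_gaussExp (b := 2 * b) (by positivity) v (2 * z)).norm.congr
    (.of_forall fun u => ?_)
  simp only [norm_gaussExp]
  rw [← Real.exp_nat_mul]
  congr 1
  simp
  ring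

/-- `gaussExp` as an element of `L²`. -/
noncomputable def gaussLp {n : ℕ} {b : ℝ} (hb : 0 < b) (v : Eucl n) (z : ℂ) : LTwo n :=
  (memLp_gaussExp hb v z).toLp

theorem coeFn_gaussLp {n : ℕ} {b : ℝ} (hb : 0 < b) (v : Eucl n) (z : ℂ) :
    gaussLp hb v z =ᵐ[volume] gaussExp b v z :=
  MemLp.coeFn_toLp _

theorem gaussExp_zero {n : ℕ} (b : ℝ) (v w : Eucl n) : gaussExp b v 0 = gaussExp b w 0 := by
  funext u; simp [gaussExp]

theorem gaussLp_zero {n : ℕ} {b : ℝ} (hb : 0 < b) (v w : Eucl n) :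
    gaussLp hb v 0 = gaussLp hb w 0 :=
  MemLp.toLp_congr _ _ (by rw [gaussExp_zero b v w])

theorem mul_le_sq_div_add_mul_sq {b : ℝ} (hb : 0 < b) (r s : ℝ) :
    r * s ≤ r ^ 2 / (2 * b) + b / 2 * s ^ 2 := by
  have h : 0 ≤ (r - b * s) ^ 2 / (2 * b) := by positivity
  have e : (r - b * s) ^ 2 / (2 * b) = r ^ 2 / (2 * b) + b / 2 * s ^ 2 - r * s := by
    field_simp; ring
  linarith

/-- Half of the Gaussian decay is spent, by completing the square, on absorbing the linear term. The
cost depends on `z` through `z.re` alone, which is what makes the critical Phragmén–Lindelöf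
argument applicable. -/
theorem norm_gaussExp_le {n : ℕ} {b : ℝ} (hb : 0 < b) (v : Eucl n) (z : ℂ) (u : Eucl n) :
    ‖gaussExp b v z u‖
      ≤ Real.exp (z.re ^ 2 * ‖v‖ ^ 2 / (2 * b)) * ‖gaussExp (b / 2) (0 : Eucl n) 0 u‖ := by
  rw [norm_gaussExp, norm_gaussExp, ← Real.exp_add]
  refine Real.exp_le_exp.2 ?_
  have h1 : z.re * inner ℝ v u ≤ (|z.re| * ‖v‖) * ‖u‖ := by
    refine (le_abs_self _).trans ?_
    rw [abs_mul, mul_assoc]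
    gcongr
    exact abs_real_inner_le_norm v u
  have h2 := mul_le_sq_div_add_mul_sq hb (|z.re| * ‖v‖) ‖u‖
  rw [mul_pow, sq_abs] at h2
  simp only [Complex.zero_re, zero_mul, add_zero]
  linarith

theorem norm_gaussLp_le {n : ℕ} {b : ℝ} (hb : 0 < b) (v : Eucl n) (z : ℂ) :
    ‖gaussLp hb v z‖ ≤ Real.exp (z.re ^ 2 * ‖v‖ ^ 2 / (2 * b)) *
      ‖gaussLp (half_pos hb) (0 : Eucl n) 0‖ := by
  refine Lp.norm_le_mul_norm_of_ae_le_mul ?_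
  filter_upwards [coeFn_gaussLp hb v z, coeFn_gaussLp (half_pos hb) (0 : Eucl n) 0] with u h1 h2
  rw [h1, h2]
  exact norm_gaussExp_le hb v z u

/-- The heat operator maps Gaussians to Gaussians. -/
theorem exists_heatFun_gaussExp {n : ℕ} {t : ℝ} (ht : 0 < t) :
    ∃ D : ℂ, D ≠ 0 ∧ ∀ (v : Eucl n) (z : ℂ) (x : Eucl n),
      heatFun t (gaussExp (Real.pi / t) v z) x =
        D * Complex.exp (z ^ 2 * ‖v‖ ^ 2 / (8 * (Real.pi / t : ℝ))) *
          gaussExp (Real.pi / t / 2) v (z / 2) x := by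
  set a : ℝ := Real.pi / t with ha
  have ha0 : 0 < a := by positivity
  have hac : (a : ℂ) ≠ 0 := by exact_mod_cast ha0.ne'
  refine ⟨(1 / t ^ ((n : ℝ) / 2) : ℝ) * (Real.pi / ((2 * a : ℝ) : ℂ)) ^ (n / 2 : ℂ), ?_, ?_⟩
  · refine mul_ne_zero ?_ ?_
    · have : (0 : ℝ) < 1 / t ^ ((n : ℝ) / 2) := by positivity
      exact_mod_cast this.ne'
    · rw [Ne, Complex.cpow_eq_zero_iff]
      rintro ⟨h, -⟩
      have : (Real.pi : ℂ) ≠ 0 := by exact_mod_cast Real.pi_ne_zero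
      have h2 : ((2 * a : ℝ) : ℂ) ≠ 0 := by exact_mod_cast (by positivity : 2 * a ≠ 0)
      exact div_ne_zero this h2 h
  intro v z x
  -- Translating `y` by `x/2` separates the variables: `|x/2 - y|² + |x/2 + y|² = |x|²/2 + 2|y|²`.
  have hpt : ∀ y : Eucl n, (heatKernel t x (y + (1 / 2 : ℝ) • x) : ℂ) *
      gaussExp a v z (y + (1 / 2 : ℝ) • x)
      = (1 / t ^ ((n : ℝ) / 2) : ℝ) * gaussExp (a / 2) v (z / 2) x * gaussExp (2 * a) v z y := by
    intro y
    have e1 : heatKernel t x (y + (1 / 2 : ℝ) • x) = 1 / t ^ ((n : ℝ) / 2) *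
        Real.exp (-a * ‖x - (y + (1 / 2 : ℝ) • x)‖ ^ 2) := by
      unfold heatKernel; congr 2; rw [ha]; ring
    have n1 : ‖x - (y + (1 / 2 : ℝ) • x)‖ ^ 2
        = ‖x‖ ^ 2 / 4 - inner ℝ x y + ‖y‖ ^ 2 := by
      have : x - (y + (1 / 2 : ℝ) • x) = (1 / 2 : ℝ) • x - y := by module
      rw [this, norm_sub_sq_real, norm_smul, real_inner_smul_left]
      norm_num
      ring
    have n2 : ‖y + (1 / 2 : ℝ) • x‖ ^ 2 = ‖x‖ ^ 2 / 4 + inner ℝ x y + ‖y‖ ^ 2 := by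
      rw [norm_add_sq_real, norm_smul, real_inner_smul_right, real_inner_comm]
      norm_num
      ring
    rw [e1, n1, Complex.ofReal_mul, mul_assoc, mul_assoc]
    congr 1
    unfold gaussExp
    rw [← Complex.ofReal_pow ‖y + (1 / 2 : ℝ) • x‖, n2, inner_add_right, real_inner_smul_right,
      Complex.ofReal_exp, ← Complex.exp_add, ← Complex.exp_add]
    congr 1
    push_cast
    ring
  have hint : ∫ y, gaussExp (2 * a) v z y = (Real.pi / ((2 * a : ℝ) : ℂ)) ^ (n / 2 : ℂ) *
      Complex.exp (z ^ 2 * ‖v‖ ^ 2 / (8 * (a : ℝ))) := by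
    have h := GaussianFourier.integral_cexp_neg_mul_sq_norm_add (V := Eucl n)
      (b := ((2 * a : ℝ) : ℂ)) (by simpa using ha0) z v
    rw [finrank_euclideanSpace_fin] at h
    refine h.trans ?_
    congr 3
    push_cast
    ring
  unfold heatFun
  rw [← integral_add_right_eq_self _ ((1 / 2 : ℝ) • x)]
  simp_rw [hpt]
  rw [integral_const_mul, hint]
  ring

/-! ### The entire function pairing `K` with Gaussians -/

theorem norm_setIntegral_mul_le {α : Type*} [MeasurableSpace α] {μ : Measure α} (A : Set α)
    (f g : Lp ℂ 2 μ) : ‖∫ x in A, f x * g x ∂μ‖ ≤ ‖f‖ * ‖g‖ := by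
  have h1 : ‖∫ x in A, f x * g x ∂μ‖ₑ ≤ eLpNorm f 2 μ * eLpNorm g 2 μ := by
    refine (enorm_integral_le_lintegral_enorm _).trans
      ((setLIntegral_le_lintegral A _).trans ?_)
    have := eLpNorm_smul_le_mul_eLpNorm (p := 2) (q := 2) (r := 1) (μ := μ)
      (Lp.aestronglyMeasurable g) (Lp.aestronglyMeasurable f)
    rw [eLpNorm_one_eq_lintegral_enorm] at this
    exact this
  rw [Lp.norm_def, Lp.norm_def, ← ENNReal.toReal_mul, ← toReal_enorm]
  exact ENNReal.toReal_mono
    (ENNReal.mul_ne_top (Lp.eLpNorm_ne_top f) (Lp.eLpNorm_ne_top g)) h1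

/-- All dependence on `z` sits in the exponential of `z` times a real linear form, so the pairing
becomes a Laplace-type integral over `(x, u)`, to which `differentiable_integral_mul_cexp` applies.
-/
theorem gaussExp_mul_gaussExp {n : ℕ} (a : ℝ) (v : Eucl n) (z : ℂ) (x u : Eucl n) :
    gaussExp a v (-z / 2) x * gaussExp a v z u =
      gaussExp a (0 : Eucl n) 0 x * gaussExp a (0 : Eucl n) 0 u *
        Complex.exp (z * (inner ℝ v u - inner ℝ v x / 2 : ℝ)) := by
  simp only [gaussExp, ← Complex.exp_add]
  congr 1
  push_cast
  ring

theorem heatKernel_le {n : ℕ} {t : ℝ} (ht : 0 < t) (x y : Eucl n) :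
    heatKernel t x y ≤ 1 / t ^ ((n : ℝ) / 2) := by
  unfold heatKernel
  have : 0 ≤ Real.pi * ‖x - y‖ ^ 2 / t := by positivity
  exact mul_le_of_le_one_right (by positivity) (Real.exp_le_one_iff.2 (by linarith))

theorem integrable_kernel_mul_gaussExp_mul_exp {n : ℕ} {t : ℝ} (ht : 0 < t)
    {k : Eucl n → Eucl n → ℂ} {μ : Measure (Eucl n)} (hμ : μ ≤ volume) [SFinite μ]
    (hk : AEStronglyMeasurable (fun z : Eucl n × Eucl n => k z.1 z.2) (μ.prod volume))
    (hkp : ∀ᵐ z : Eucl n × Eucl n ∂(μ.prod volume), ‖k z.1 z.2‖ ≤ heatKernel t z.1 z.2)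
    {a : ℝ} (ha : 0 < a) (v : Eucl n) (R : ℝ) :
    Integrable (fun z : Eucl n × Eucl n =>
      ‖k z.1 z.2 * (gaussExp a (0 : Eucl n) 0 z.1 * gaussExp a (0 : Eucl n) 0 z.2)‖ *
        Real.exp (R * |inner ℝ v z.2 - inner ℝ v z.1 / 2|)) (μ.prod volume) := by
  have hi := (integrable_gaussExp (half_pos ha) (0 : Eucl n) 0).norm
  have hb := ((hi.mono_measure hμ).mul_prod hi).const_mul
    (1 / t ^ ((n : ℝ) / 2) * Real.exp (2 * ((|R| * ‖v‖) ^ 2 / (2 * a))))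
  refine hb.mono' ?_ ?_
  · refine AEStronglyMeasurable.mul (hk.mul ?_).norm ?_
    · exact (((continuous_gaussExp _ _ _).comp continuous_fst).mul
        ((continuous_gaussExp _ _ _).comp continuous_snd)).aestronglyMeasurable
    · exact Continuous.aestronglyMeasurable (by fun_prop)
  · filter_upwards [hkp] with z hz
    rw [Real.norm_of_nonneg (by positivity), norm_mul, norm_mul, mul_assoc,
      mul_assoc (1 / t ^ ((n : ℝ) / 2))]
    have hL : R * |inner ℝ v z.2 - inner ℝ v z.1 / 2|
        ≤ (|R| * ‖v‖) * ‖z.2‖ + (|R| * ‖v‖) * ‖z.1‖ := by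
      have h1 := abs_real_inner_le_norm v z.2
      have h2 := abs_real_inner_le_norm v z.1
      have h3 : |inner ℝ v z.2 - inner ℝ v z.1 / 2| ≤ ‖v‖ * ‖z.2‖ + ‖v‖ * ‖z.1‖ := by
        refine (abs_sub _ _).trans ?_
        rw [abs_div, abs_two]
        have := abs_nonneg (inner ℝ v z.1)
        linarith
      calc _ ≤ |R| * (‖v‖ * ‖z.2‖ + ‖v‖ * ‖z.1‖) := by
            refine mul_le_mul (le_abs_self R) h3 (abs_nonneg _) (abs_nonneg _)
        _ = _ := by ring
    have h1 := mul_le_sq_div_add_mul_sq ha (|R| * ‖v‖) ‖z.1‖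
    have h2 := mul_le_sq_div_add_mul_sq ha (|R| * ‖v‖) ‖z.2‖
    refine mul_le_mul (hz.trans (heatKernel_le ht _ _)) ?_ (by positivity) (by positivity)
    simp only [norm_gaussExp, Complex.zero_re, zero_mul, add_zero, ← Real.exp_add]
    refine Real.exp_le_exp.2 ?_
    linarith

theorem HasKernel.apply_gaussLp {n : ℕ} {K : LTwo n →ₗ[ℂ] LTwo n} {k : Eucl n → Eucl n → ℂ}
    (hK : HasKernel K k) {a : ℝ} (ha : 0 < a) (v : Eucl n) (z : ℂ) :
    ∀ᵐ x, K (gaussLp ha v z) x = ∫ u, k x u * gaussExp a v z u := by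
  filter_upwards [hK (gaussLp ha v z)] with x hx
  rw [hx.2]
  refine integral_congr_ae ?_
  filter_upwards [coeFn_gaussLp ha v z] with u hu
  rw [hu]

/-- Here `D` is the full scalar factor for the given `v` and `z`, including `exp(z²|v|²/(8a))`. -/
theorem norm_heatOp_gaussLp_le {n : ℕ} {t : ℝ} (ht : 0 < t) (ha : 0 < Real.pi / t) {D : ℂ}
    {v : Eucl n} {z : ℂ}
    (hD : ∀ x : Eucl n, heatFun t (gaussExp (Real.pi / t) v z) x =
      D * gaussExp (Real.pi / t / 2) v (z / 2) x) :
    ‖heatOp n ht (gaussLp ha v z)‖ ≤ ‖D‖ * ‖gaussLp (half_pos ha) v (z / 2)‖ := by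
  refine Lp.norm_le_mul_norm_of_ae_le_mul ?_
  filter_upwards [(heatOp_hasKernel n ht).apply_gaussLp ha v z,
    coeFn_gaussLp (half_pos ha) v (z / 2)] with x hx h2
  rw [hx, h2, ← norm_mul, ← hD x]
  rfl

/-- For real parameters the kernel bound is inherited by the images of Gaussians. -/
theorem norm_integral_kernel_mul_gaussExp_le {n : ℕ} {t : ℝ} (ht : 0 < t)
    {k : Eucl n → ℂ} {x : Eucl n} (hkp : ∀ᵐ y, ‖k y‖ ≤ heatKernel t x y)
    {a : ℝ} (ha : 0 < a) (v : Eucl n) (r : ℝ) :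
    ‖∫ u, k u * gaussExp a v r u‖ ≤ ‖heatFun t (gaussExp a v r) x‖ := by
  have hpos : ∀ u, gaussExp a v r u = (‖gaussExp a v r u‖ : ℂ) := by
    intro u
    rw [norm_gaussExp, gaussExp, Complex.ofReal_exp]
    push_cast
    rfl
  have e : heatFun t (gaussExp a v r) x =
      ((∫ u, heatKernel t x u * ‖gaussExp a v r u‖ : ℝ) : ℂ) := by
    rw [← integral_complex_ofReal, heatFun]
    refine integral_congr_ae (.of_forall fun u => ?_)
    simp only
    rw [hpos u]
    simp
  have hnn : ∀ u, 0 ≤ heatKernel t x u * ‖gaussExp a v r u‖ := fun u =>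
    mul_nonneg (heatKernel_nonneg ht x u) (norm_nonneg _)
  rw [e, Complex.norm_real, Real.norm_of_nonneg (integral_nonneg hnn)]
  refine norm_integral_le_of_norm_le ?_ ?_
  · refine (integrable_heatKernel_mul ht x (memLp_gaussExp ha v r)).norm.congr
      (.of_forall fun u => ?_)
    simp only
    rw [norm_mul, Complex.norm_real, Real.norm_of_nonneg (heatKernel_nonneg ht x u)]
  · filter_upwards [hkp] with u hu
    rw [norm_mul]
    gcongr

theorem differentiable_setIntegral_gaussLp {n : ℕ} {t : ℝ} (ht : 0 < t)
    {K : LTwo n →ₗ[ℂ] LTwo n} {k : Eucl n → Eucl n → ℂ}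
    (hk : AEStronglyMeasurable (fun z : Eucl n × Eucl n => k z.1 z.2))
    (hK : HasKernel K k)
    (hkp : ∀ᵐ z : Eucl n × Eucl n, ‖k z.1 z.2‖ ≤ heatKernel t z.1 z.2)
    {a : ℝ} (ha : 0 < a) (v : Eucl n) (A : Set (Eucl n)) :
    Differentiable ℂ fun z : ℂ =>
      ∫ x in A, gaussLp ha v (-z / 2) x * K (gaussLp ha v z) x := by
  have hac : (volume.restrict A).prod (volume : Measure (Eucl n)) ≪
      (volume : Measure (Eucl n × Eucl n)) :=
    (Measure.restrict_le_self.absolutelyContinuous).prod Measure.AbsolutelyContinuous.rfl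
  have hk' := hk.mono_ac hac
  have hint := fun R : ℝ => integrable_kernel_mul_gaussExp_mul_exp ht Measure.restrict_le_self hk'
    (hac.ae_le hkp) ha v R
  have hm : AEStronglyMeasurable (fun z : Eucl n × Eucl n =>
      k z.1 z.2 * (gaussExp a (0 : Eucl n) 0 z.1 * gaussExp a (0 : Eucl n) 0 z.2))
      ((volume.restrict A).prod volume) :=
    hk'.mul (((continuous_gaussExp _ _ _).comp continuous_fst).mul
        ((continuous_gaussExp _ _ _).comp continuous_snd)).aestronglyMeasurable
  have hL : Continuous fun z : Eucl n × Eucl n => inner ℝ v z.2 - inner ℝ v z.1 / 2 := by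
    fun_prop
  have hd := differentiable_integral_mul_cexp hm hL.aemeasurable hint
  -- Fubini identifies the pairing with the double integral.
  convert! hd using 2 with z
  have hi : Integrable (fun p : Eucl n × Eucl n =>
      k p.1 p.2 * (gaussExp a (0 : Eucl n) 0 p.1 * gaussExp a (0 : Eucl n) 0 p.2) *
        Complex.exp (z * (inner ℝ v p.2 - inner ℝ v p.1 / 2 : ℝ)))
      ((volume.restrict A).prod volume) := by
    refine (hint ‖z‖).mono' (hm.mul (Continuous.aestronglyMeasurable (by fun_prop))) ?_
    refine .of_forall fun p => ?_
    rw [norm_mul]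
    gcongr
    refine (Complex.norm_exp_le_exp_norm _).trans ?_
    rw [norm_mul, Complex.norm_real, Real.norm_eq_abs]
  rw [integral_prod _ hi]
  refine integral_congr_ae ?_
  filter_upwards [ae_restrict_of_ae (coeFn_gaussLp ha v (-z / 2)),
    ae_restrict_of_ae (hK.apply_gaussLp ha v z)] with x h1 h2
  rw [h1, h2, ← integral_const_mul]
  refine integral_congr_ae (.of_forall fun u => ?_)
  simp only
  rw [mul_assoc, ← gaussExp_mul_gaussExp]
  ring

/-- The cross-multiplied form of the statement that `K g_z / P_t g_z` depends on neither `z` nor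
`v`. -/
theorem ae_apply_gaussLp_eq {n : ℕ} {t : ℝ} (ht : 0 < t)
    {K : LTwo n →ₗ[ℂ] LTwo n} {k : Eucl n → Eucl n → ℂ}
    (hk : AEStronglyMeasurable (fun z : Eucl n × Eucl n => k z.1 z.2))
    (hK : HasKernel K k)
    (hkp : ∀ᵐ z : Eucl n × Eucl n, ‖k z.1 z.2‖ ≤ heatKernel t z.1 z.2)
    (hKP : ∀ f : LTwo n, ‖K f‖ ≤ ‖heatOp n ht f‖)
    (ha : 0 < Real.pi / t) (v : Eucl n) (z : ℂ) :
    ∀ᵐ x, heatFun t (gaussExp (Real.pi / t) (0 : Eucl n) 0) x * K (gaussLp ha v z) x =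
      heatFun t (gaussExp (Real.pi / t) v z) x * K (gaussLp ha (0 : Eucl n) 0) x := by
  obtain ⟨D, hD0, hD⟩ := exists_heatFun_gaussExp (n := n) ht
  set a : ℝ := Real.pi / t with hadef
  let E : ℂ → ℂ := fun z => Complex.exp (-(z ^ 2 * ‖v‖ ^ 2 / (8 * (a : ℝ))))
  have hE : ∀ z, E z * Complex.exp (z ^ 2 * ‖v‖ ^ 2 / (8 * (a : ℝ))) = 1 := fun z => by
    simp only [E]; rw [← Complex.exp_add]; simp
  have hEd : Differentiable ℂ E := by fun_prop
  let G : Set (Eucl n) → ℂ → ℂ := fun A z =>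
    E z * ∫ x in A, gaussLp ha v (-z / 2) x * K (gaussLp ha v z) x
  have hGd : ∀ A, Differentiable ℂ (G A) := fun A =>
    hEd.mul (differentiable_setIntegral_gaussLp ht hk hK hkp ha v A)
  set N1 := ‖gaussLp (half_pos ha) (0 : Eucl n) 0‖
  set N2 := ‖gaussLp (half_pos (half_pos ha)) (0 : Eucl n) 0‖
  set β : ℝ := ‖v‖ ^ 2 / (8 * a) + ‖v‖ ^ 2 / (4 * a) with hβ
  have hgrow : ∀ A z, ‖G A z‖ ≤ ‖D‖ * N1 * N2 * Real.exp (β * z.re ^ 2) := by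
    intro A z
    have h1 := norm_setIntegral_mul_le A (gaussLp ha v (-z / 2)) (K (gaussLp ha v z))
    have h2 := (hKP (gaussLp ha v z)).trans (norm_heatOp_gaussLp_le ht ha (hD v z))
    have h3 := norm_gaussLp_le ha v (-z / 2)
    have h4 := norm_gaussLp_le (half_pos ha) v (z / 2)
    have hzr : (z / 2).re = z.re / 2 := by simp
    have hzr' : (-z / 2).re = -z.re / 2 := by simp
    -- `E` cancels the exponential produced by the heat operator exactly; what remains grows only
    -- with `z.re`.
    have hEn : ‖E z‖ * ‖D * Complex.exp (z ^ 2 * ‖v‖ ^ 2 / (8 * (a : ℝ)))‖ = ‖D‖ := by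
      rw [← norm_mul, mul_left_comm, hE, mul_one]
    rw [hzr'] at h3
    rw [hzr] at h4
    calc ‖G A z‖ ≤ ‖E z‖ * ((Real.exp ((-z.re / 2) ^ 2 * ‖v‖ ^ 2 / (2 * a)) * N1) *
          (‖D * Complex.exp (z ^ 2 * ‖v‖ ^ 2 / (8 * (a : ℝ)))‖ *
          (Real.exp ((z.re / 2) ^ 2 * ‖v‖ ^ 2 / (2 * (a / 2))) * N2))) := by
          simp only [G]
          rw [norm_mul]
          refine mul_le_mul_of_nonneg_left (h1.trans ?_) (norm_nonneg _)
          exact mul_le_mul h3 (h2.trans (mul_le_mul_of_nonneg_left h4 (norm_nonneg _)))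
            (norm_nonneg _) ((norm_nonneg _).trans h3)
      _ = (‖E z‖ * ‖D * Complex.exp (z ^ 2 * ‖v‖ ^ 2 / (8 * (a : ℝ)))‖) * N1 * N2 *
          (Real.exp ((-z.re / 2) ^ 2 * ‖v‖ ^ 2 / (2 * a)) *
            Real.exp ((z.re / 2) ^ 2 * ‖v‖ ^ 2 / (2 * (a / 2)))) := by ring
      _ = _ := by
          rw [hEn, ← Real.exp_add]
          congr 2
          rw [hβ]
          field_simp
          ring
  have hi32 : Integrable fun x : Eucl n => ‖D‖ * ‖gaussExp (a + a / 2) (0 : Eucl n) 0 x‖ :=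
    (integrable_gaussExp (by positivity) _ _).norm.const_mul _
  set C2 := ∫ x : Eucl n, ‖D‖ * ‖gaussExp (a + a / 2) (0 : Eucl n) 0 x‖
  have hprod : ∀ x z, gaussExp a v (-z / 2) x * gaussExp (a / 2) v (z / 2) x =
      gaussExp (a + a / 2) (0 : Eucl n) 0 x := by
    intro x z
    simp only [gaussExp, ← Complex.exp_add]
    congr 1
    push_cast
    simp only [inner_zero_left, Complex.ofReal_zero]
    ring
  -- Domination by `P_t g_r` makes the integrand at most the fixed Gaussian `|D| exp(-(3a/2)|x|²)`,
  -- whose integral bounds `G A r` for every `A` and `r`.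
  have hreal : ∀ A (r : ℝ), ‖G A r‖ ≤ C2 := by
    intro A r
    simp only [G]
    rw [← integral_const_mul]
    refine (norm_integral_le_of_norm_le hi32.restrict (ae_restrict_of_ae ?_)).trans
      (setIntegral_le_integral hi32 (.of_forall fun x => by positivity))
    filter_upwards [coeFn_gaussLp ha v (-r / 2), hK.apply_gaussLp ha v r,
      Measure.ae_ae_of_ae_prod hkp] with x h1 h2 h3
    have h4 := norm_integral_kernel_mul_gaussExp_le ht h3 ha v r
    rw [hD v r x] at h4
    rw [h1, h2, norm_mul, norm_mul]
    calc _ ≤ ‖E r‖ * (‖gaussExp a v (-r / 2) x‖ *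
          ‖D * Complex.exp ((r : ℂ) ^ 2 * ‖v‖ ^ 2 / (8 * (a : ℝ))) *
            gaussExp (a / 2) v (r / 2) x‖) := by gcongr
      _ = ‖(E r * Complex.exp ((r : ℂ) ^ 2 * ‖v‖ ^ 2 / (8 * (a : ℝ)))) * D *
          (gaussExp a v (-r / 2) x * gaussExp (a / 2) v (r / 2) x)‖ := by
          simp only [norm_mul]; ring
      _ = _ := by rw [hE, hprod, one_mul, norm_mul]
  have hconst : ∀ A, G A z = G A 0 := by
    intro A
    -- `β + 1` rather than `β`, because `β = 0` when `v = 0`.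
    refine apply_eq_apply_of_re_sq_growth (hGd A) (C := max (‖D‖ * N1 * N2) C2) (β := β + 1)
      (by positivity) (fun w => (hgrow A w).trans ?_) (fun r => (hreal A r).trans (le_max_right _ _))
      z 0
    gcongr
    · exact le_max_left _ _
    · linarith
  have hil : ∀ w : ℂ, Integrable fun x =>
      E w * (gaussLp ha v (-w / 2) x * K (gaussLp ha v w) x) := fun w =>
    ((Lp.memLp _).integrable_mul (Lp.memLp _)).const_mul _
  -- Equality of the integrals over every set `A` descends to the integrands.
  have hae := Integrable.ae_eq_of_forall_setIntegral_eq _ _ (hil z) (hil 0) fun A _ _ => by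
    rw [integral_const_mul, integral_const_mul]
    exact hconst A
  filter_upwards [hae, coeFn_gaussLp ha v (-z / 2), coeFn_gaussLp ha v (-0 / 2)] with x hx h1 h2
  rw [h1, h2, gaussLp_zero ha v 0] at hx
  have hE0 : E 0 = 1 := by simp [E]
  have hF0 : heatFun t (gaussExp a (0 : Eucl n) 0) x = D * gaussExp (a / 2) v (0 / 2) x := by
    rw [hD]
    simp [gaussExp]
  have hEz := hE z
  have hEinv : Complex.exp (z ^ 2 * ‖v‖ ^ 2 / (8 * (a : ℝ))) ≠ 0 := Complex.exp_ne_zero _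
  have hg : gaussExp a v (-z / 2) x ≠ 0 := Complex.exp_ne_zero _
  have hpz := hprod x z
  have hp0 := hprod x 0
  rw [hF0, hD v z x]
  rw [hE0, one_mul] at hx
  refine mul_left_cancel₀ (mul_ne_zero hg (left_ne_zero_of_mul_eq_one hEz)) ?_
  set g1 := gaussExp a v (-z / 2) x
  set g2 := gaussExp (a / 2) v (z / 2) x
  set g3 := gaussExp a v (-0 / 2) x
  set g4 := gaussExp (a / 2) v (0 / 2) x
  set K1 := K (gaussLp ha v z) x
  set K0 := K (gaussLp ha (0 : Eucl n) 0) x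
  set e := Complex.exp (z ^ 2 * ‖v‖ ^ 2 / (8 * (a : ℝ)))
  linear_combination (D * g4) * hx - D * g1 * g2 * K0 * hEz - D * K0 * hpz + D * K0 * hp0

/-! ### Recovering the kernel from the Gaussian identities -/

theorem exists_kernel_eq_mul_heatKernel {n : ℕ} {t : ℝ} (ht : 0 < t)
    {K : LTwo n →ₗ[ℂ] LTwo n} {k : Eucl n → Eucl n → ℂ}
    (hk : AEStronglyMeasurable (fun z : Eucl n × Eucl n => k z.1 z.2))
    (hK : HasKernel K k)
    (hkp : ∀ᵐ z : Eucl n × Eucl n, ‖k z.1 z.2‖ ≤ heatKernel t z.1 z.2)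
    (hKP : ∀ f : LTwo n, ‖K f‖ ≤ ‖heatOp n ht f‖) :
    ∃ m : Eucl n → ℂ, Measurable m ∧ (∀ x, ‖m x‖ ≤ 1) ∧
      ∀ᵐ x, ∀ᵐ y, k x y = m x * (heatKernel t x y : ℂ) := by
  have ha : 0 < Real.pi / t := by positivity
  obtain ⟨D, hD0, hD⟩ := exists_heatFun_gaussExp (n := n) ht
  set a : ℝ := Real.pi / t
  set P0 : Eucl n → ℂ := heatFun t (gaussExp a (0 : Eucl n) 0)
  have hP0 : ∀ x, P0 x ≠ 0 := fun x => by
    simp only [P0]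
    rw [hD]
    exact mul_ne_zero (mul_ne_zero hD0 (Complex.exp_ne_zero _)) (Complex.exp_ne_zero _)
  have hP0m : AEStronglyMeasurable P0 :=
    aestronglyMeasurable_heatFun t (continuous_gaussExp _ _ _).aestronglyMeasurable
  have hqm : AEMeasurable fun x => K (gaussLp ha (0 : Eucl n) 0) x / P0 x :=
    (Lp.aestronglyMeasurable _).aemeasurable.div hP0m.aemeasurable
  let m₀ := hqm.mk
  have hm₀ : Measurable m₀ := hqm.measurable_mk
  -- The quotient is bounded by 1 only almost everywhere; cutting off to `S` makes the bound hold at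
  -- every point.
  let S : Set (Eucl n) := {x | ‖m₀ x‖ ≤ 1}
  have hS : MeasurableSet S := measurableSet_le hm₀.norm measurable_const
  refine ⟨S.indicator m₀, hm₀.indicator hS, fun x => ?_, ?_⟩
  · by_cases hx : x ∈ S
    · rw [Set.indicator_of_mem hx]; exact hx
    · rw [Set.indicator_of_notMem hx]; simp
  have hkx := Measure.ae_ae_of_ae_prod hkp
  have hkm : ∀ᵐ x : Eucl n, AEStronglyMeasurable (fun y => k x y) := hk.prodMk_left
  -- The exceptional null set depends on `v`, so only countably many `v` are used here; continuity
  -- in `v` gives the rest for fixed `x`.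
  have hdense : ∀ᵐ x, ∀ j : ℕ,
      P0 x * K (gaussLp ha (TopologicalSpace.denseSeq (Eucl n) j) Complex.I) x =
      heatFun t (gaussExp a (TopologicalSpace.denseSeq (Eucl n) j) Complex.I) x *
        K (gaussLp ha (0 : Eucl n) 0) x :=
    ae_all_iff.2 fun j => ae_apply_gaussLp_eq ht hk hK hkp hKP ha _ _
  have hKd : ∀ᵐ x, ∀ j : ℕ, K (gaussLp ha (TopologicalSpace.denseSeq (Eucl n) j) Complex.I) x =
      ∫ u, k x u * gaussExp a (TopologicalSpace.denseSeq (Eucl n) j) Complex.I u :=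
    ae_all_iff.2 fun j => hK.apply_gaussLp ha _ _
  filter_upwards [hkx, hkm, hdense, hKd, hK.apply_gaussLp ha (0 : Eucl n) 0, hqm.ae_eq_mk]
    with x h1 h2 h3 h4 h5 h6
  have hmx : m₀ x = K (gaussLp ha (0 : Eucl n) 0) x / P0 x := h6.symm
  have hxS : x ∈ S := by
    change ‖m₀ x‖ ≤ 1
    rw [hmx, norm_div, div_le_one (norm_pos_iff.2 (hP0 x)), h5]
    simpa using norm_integral_kernel_mul_gaussExp_le ht h1 ha (0 : Eucl n) 0
  rw [Set.indicator_of_mem hxS]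
  set g : Eucl n → ℂ := fun u => (k x u - m₀ x * heatKernel t x u) * gaussExp a (0 : Eucl n) 0 u
    with hg
  have hki : Integrable fun u => k x u :=
    (integrable_heatKernel ht x).mono' h2 h1
  have hdi : Integrable fun u => k x u - m₀ x * heatKernel t x u :=
    hki.sub ((integrable_heatKernel ht x).ofReal.const_mul _)
  have hbg : ∀ v : Eucl n, ∀ u, ‖gaussExp a v Complex.I u‖ ≤ 1 := by
    intro v u
    rw [norm_gaussExp, Real.exp_le_one_iff]
    simp only [Complex.I_re, zero_mul, add_zero]
    have : 0 ≤ a * ‖u‖ ^ 2 := by positivity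
    linarith
  have hbi : ∀ (v : Eucl n) (f : Eucl n → ℂ), Integrable f →
      Integrable fun u => f u * gaussExp a v Complex.I u := fun v f hf =>
    hf.mul_bdd (continuous_gaussExp _ _ _).aestronglyMeasurable (.of_forall (hbg v))
  have hgi : Integrable g := by
    refine hdi.mul_bdd (c := 1) (continuous_gaussExp _ _ _).aestronglyMeasurable (.of_forall ?_)
    intro u
    have := hbg 0 u
    rwa [norm_gaussExp] at this ⊢
  have hcont : Continuous fun v : Eucl n =>
      ∫ u, (k x u - m₀ x * heatKernel t x u) * gaussExp a v Complex.I u := by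
    refine continuous_of_dominated (bound := fun u => ‖k x u - m₀ x * heatKernel t x u‖)
      (fun v => (hbi v _ hdi).aestronglyMeasurable) (fun v => .of_forall fun u => ?_) hdi.norm
      (.of_forall fun u => ?_)
    · rw [norm_mul]
      exact mul_le_of_le_one_right (norm_nonneg _) (hbg v u)
    · unfold gaussExp
      fun_prop
  have hzero : ∀ v : Eucl n,
      ∫ u, (k x u - m₀ x * heatKernel t x u) * gaussExp a v Complex.I u = 0 := by
    have := hcont.ext_on (TopologicalSpace.denseRange_denseSeq (Eucl n)) continuous_const
      (g := fun _ => (0 : ℂ)) ?_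
    · exact fun v => congrFun this v
    rintro _ ⟨j, rfl⟩
    simp only [sub_mul]
    rw [integral_sub (hbi _ _ hki) (hbi _ (fun u => m₀ x * (heatKernel t x u : ℂ))
      ((integrable_heatKernel ht x).ofReal.const_mul _)), ← h4 j]
    simp only [mul_assoc]
    rw [integral_const_mul, hmx, sub_eq_zero, div_mul_eq_mul_div, eq_div_iff (hP0 x), mul_comm,
      h3 j, mul_comm]
    rfl
  have hfz : ∀ ξ, FourierTransform.fourier g ξ = 0 := by
    intro ξ
    -- The Fourier character at `ξ` is the oscillating factor of `gaussExp a v Complex.I` with `v =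
    -- -2πξ`.
    rw [Real.fourier_eq']
    rw [← hzero ((-2 * Real.pi) • ξ)]
    refine integral_congr_ae (.of_forall fun u => ?_)
    simp only [hg, smul_eq_mul]
    rw [mul_left_comm]
    congr 1
    simp only [gaussExp, ← Complex.exp_add]
    congr 1
    rw [real_inner_smul_left, real_inner_comm]
    push_cast
    ring
  filter_upwards [ae_eq_zero_of_fourier_eq_zero hgi hfz] with u hu
  exact sub_eq_zero.1 ((mul_eq_zero.1 hu).resolve_right (Complex.exp_ne_zero _))

theorem theorem2 (n : ℕ) (t : ℝ) (ht : 0 < t)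
    (K : LTwo n →ₗ[ℂ] LTwo n) (k : Eucl n → Eucl n → ℂ)
    (hk : LocallyIntegrable (fun z : Eucl n × Eucl n => k z.1 z.2) volume)
    (hK : HasKernel K k)
    (hkp : ∀ᵐ z : Eucl n × Eucl n, ‖k z.1 z.2‖ ≤ heatKernel t z.1 z.2)
    (hKP : ∀ f : LTwo n, ‖K f‖ ≤ ‖heatOp n ht f‖) :
    ∃ m : Eucl n → ℂ, Measurable m ∧ (∃ C : ℝ, ∀ x, ‖m x‖ ≤ C) ∧
      (∀ᵐ z : Eucl n × Eucl n, k z.1 z.2 = m z.1 * (heatKernel t z.1 z.2 : ℂ)) ∧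
      (∀ f : LTwo n, ∀ᵐ x : Eucl n, K f x = m x * heatOp n ht f x) := by
  have hkm := hk.aestronglyMeasurable
  obtain ⟨m, hm, hm1, h⟩ := exists_kernel_eq_mul_heatKernel ht hkm hK hkp hKP
  refine ⟨m, hm, ⟨1, hm1⟩, ?_, fun f => ?_⟩
  -- Passing from iterated to product almost-everywhere needs a measurable set, hence the measurable
  -- representative of `k`.
  · have hmk : (fun z : Eucl n × Eucl n => k z.1 z.2) =ᵐ[volume.prod volume] hkm.mk :=
      hkm.ae_eq_mk
    have hset : MeasurableSet {z : Eucl n × Eucl n |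
        hkm.mk _ z = m z.1 * (heatKernel t z.1 z.2 : ℂ)} :=
      measurableSet_eq_fun hkm.stronglyMeasurable_mk.measurable
        ((hm.comp measurable_fst).mul
          (Complex.continuous_ofReal.comp (continuous_heatKernel t)).measurable)
    have hprod := (Measure.ae_prod_iff_ae_ae (μ := volume) (ν := volume) hset).2 (by
      filter_upwards [h, Measure.ae_ae_of_ae_prod hmk] with x hx hx'
      filter_upwards [hx, hx'] with y hy hy'
      rw [← hy', hy])
    filter_upwards [hmk, hprod] with z hz hz'
    exact hz.trans hz'
  · filter_upwards [h, hK f, heatOp_hasKernel n ht f] with x hx h1 h2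
    rw [h1.2, h2.2, ← integral_const_mul]
    refine integral_congr_ae ?_
    filter_upwards [hx] with y hy
    rw [hy, mul_assoc]
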